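/- Let $p \ge 5$ be a prime, let $3 \le k \le p$, and let $S$ be a finite $p$-group. For a subgroup $H \le S$ write $\Omega_1(H)$ for the subgroup generated by the elements $x\in H$ with $x^p=1$, and for $A,B\le S$ put $[A,B;0]=A$ and $[A,B;n]=[[A,B;n-1],B]$. Let $\mathfrak{X}_k(S)$ (the $k$-th Oliver subgroup) be the largest subgroup $X$ of $S$ for which there is a series $1=Q_0<Q_1<\dots<Q_n=X$ of normal subgroups of $S$ with $[\Omega_1(C_S(Q_{i-1})),Q_i;k-1]=1$ for all $1\le i\le n$. Let $J_e(S)$ be the subgroup of $S$ generated by the elementary abelian subgroups of $S$ of maximum order. Suppose that $J_e(S)\not\le \mathfrak{X}_k(S)$, and set $G=S/\mathfrak{X}_k(S)$ and $V=\Omega_1(Z(\mathfrak{X}_k(S)))$, regarded as an $\mathbb{F}_p$-vector space on which $G$ acts by conjugation. Then $G$ acts faithfully on $V$, and there exist a subgroup $W$ of $G$ and an element $a\in G$ such that 1. $a$ is quadratic on $V$, that is, the minimal polynomial of $a$ on $V$ over $\mathbb{F}_p$ has degree $2$; 2. $W=\langle a^G\rangle$ is the subgroup generated by the $G$-conjugates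 of $a$; 3. $W$ is normal in $G$ and elementary abelian; 4. for every $x\in G$, either $[W,x]=1$ or $[W,x,x]\ne 1$, where $[H,x]$ denotes the subgroup generated by the commutators $[h,x]$ with $h\in H$, and $[W,x,x]=[[W,x],x]$. -/

import Mathlib

open scoped commutatorElement

namespace OliverGroup

variable {S : Type*} [Group S]

/-- `A` is an elementary abelian `p`-subgroup (the trivial subgroup is allowed). -/
def IsElemAb (p : ℕ) (A : Subgroup S) : Prop :=
  (∀ x ∈ A, ∀ y ∈ A, x * y = y * x) ∧ ∀ x ∈ A, x ^ p = 1

/-- The Thompson subgroup `J_e(S)`: generated by the elementary abelian `p`-subgroups of `S` of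
maximum order. -/
def thompson (p : ℕ) (S : Type*) [Group S] : Subgroup S :=
  sSup {A | IsElemAb p A ∧ ∀ B : Subgroup S, IsElemAb p B → Nat.card B ≤ Nat.card A}

/-- `Ω₁(H)`: the subgroup generated by the elements `x` of `H` with `x ^ p = 1`. -/
def omegaOne (p : ℕ) (H : Subgroup S) : Subgroup S :=
  Subgroup.closure {x | x ∈ H ∧ x ^ p = 1}

/-- The iterated commutator subgroup `[A, B; n] = [A, B, …, B]` with `n` copies of `B`. -/
def iterComm (A B : Subgroup S) : ℕ → Subgroup S
  | 0 => A
  | n + 1 => ⁅iterComm A B n, B⁆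

/-- There is a series `1 = Q₀ < Q₁ < ⋯ < Qₙ = X` of normal subgroups of `S` with
`[Ω₁(C_S(Q_{i-1})), Q_i; k - 1] = 1` for `1 ≤ i ≤ n`. -/
def HasOliverSeries (p k : ℕ) (X : Subgroup S) : Prop :=
  ∃ (n : ℕ) (Q : ℕ → Subgroup S), Q 0 = ⊥ ∧ Q n = X ∧ (∀ i ≤ n, (Q i).Normal) ∧
    ∀ i < n, Q i < Q (i + 1) ∧
      iterComm (omegaOne p (Subgroup.centralizer (Q i : Set S))) (Q (i + 1)) (k - 1) = ⊥

/-- The `k`-th Oliver subgroup `X_k(S)`: the largest subgroup admitting such a series. It is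
written as a supremum; `isGreatest_oliver` shows that this is a largest element. -/
def oliver (p k : ℕ) (S : Type*) [Group S] : Subgroup S :=
  sSup {X | HasOliverSeries p k X}

theorem HasOliverSeries.normal {p k : ℕ} {X : Subgroup S} (h : HasOliverSeries p k X) :
    X.Normal := by
  obtain ⟨n, Q, -, rfl, h, -⟩ := h
  exact h n le_rfl

instance oliver_normal (p k : ℕ) : (oliver p k S).Normal :=
  Subgroup.sSup_normal _ fun _ h => h.normal

theorem HasOliverSeries.bot (p k : ℕ) : HasOliverSeries p k (⊥ : Subgroup S) :=
  ⟨0, fun _ => ⊥, rfl, rfl, fun _ _ => inferInstance, fun _ h => absurd h (Nat.not_lt_zero _)⟩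

theorem HasOliverSeries.extend {p k : ℕ} {P R : Subgroup S} (hP : HasOliverSeries p k P)
    (hR : R.Normal) (hPR : P ≤ R)
    (h : iterComm (omegaOne p (Subgroup.centralizer (P : Set S))) R (k - 1) = ⊥) :
    HasOliverSeries p k R := by
  rcases hPR.eq_or_lt with rfl | hlt
  · exact hP
  obtain ⟨n, Q, h0, hn, hN, hs⟩ := hP
  refine ⟨n + 1, fun i => if i ≤ n then Q i else R, by simpa using h0, by simp, ?_, ?_⟩
  · intro i _
    by_cases hi : i ≤ n
    · simpa [hi] using hN i hi
    · simpa [hi] using hR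
  · intro i hi
    have hi' : i ≤ n := Nat.lt_succ_iff.1 hi
    rcases hi'.eq_or_lt with rfl | hlt'
    · simpa [hn] using ⟨hlt, h⟩
    · have : i + 1 ≤ n := hlt'
      simpa [hi', this] using hs i hlt'

theorem omegaOne_mono (p : ℕ) {H K : Subgroup S} (h : H ≤ K) : omegaOne p H ≤ omegaOne p K :=
  Subgroup.closure_mono fun _ hx => ⟨h hx.1, hx.2⟩

theorem omegaOne_le (p : ℕ) (H : Subgroup S) : omegaOne p H ≤ H :=
  (Subgroup.closure_le _).2 fun _ hx => hx.1

theorem omegaOne_normal (p : ℕ) {H : Subgroup S} (hH : H.Normal) : (omegaOne p H).Normal := by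
  refine ⟨fun x hx g => ?_⟩
  induction hx using Subgroup.closure_induction with
  | mem x hx =>
    refine Subgroup.subset_closure ⟨hH.conj_mem x hx.1 g, ?_⟩
    rw [conj_pow, hx.2]
    simp
  | one => simp
  | mul x y _ _ hx hy =>
    have := Subgroup.mul_mem _ hx hy
    rwa [conj_mul] at this
  | inv x _ hx =>
    have := Subgroup.inv_mem _ hx
    rwa [conj_inv] at this

theorem iterComm_normal {A B : Subgroup S} (hA : A.Normal) (hB : B.Normal) (n : ℕ) :
    (iterComm A B n).Normal := by
  induction n with
  | zero => exact hA
  | succ n ih => exact Subgroup.commutator_normal _ _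

theorem iterComm_le {A B : Subgroup S} (hA : A.Normal) (hB : B.Normal) (n : ℕ) :
    iterComm A B n ≤ A := by
  induction n with
  | zero => exact le_rfl
  | succ n ih =>
    have := iterComm_normal hA hB n
    exact (Subgroup.commutator_le_left _ _).trans ih

theorem iterComm_mono {A A' : Subgroup S} (h : A ≤ A') (B : Subgroup S) (n : ℕ) :
    iterComm A B n ≤ iterComm A' B n := by
  induction n with
  | zero => exact h
  | succ n ih => exact Subgroup.commutator_mono ih le_rfl

theorem iterComm_sup_le {A P R : Subgroup S} (hA : A.Normal) (hP : P.Normal) (hR : R.Normal)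
    (hAP : A ≤ Subgroup.centralizer (P : Set S)) (n : ℕ) :
    iterComm A (P ⊔ R) n ≤ iterComm A R n := by
  induction n with
  | zero => exact le_rfl
  | succ n ih =>
    have hN := iterComm_normal hA hR n
    refine (Subgroup.commutator_mono ih le_rfl).trans (Subgroup.commutator_le.2 ?_)
    intro a ha g hg
    obtain ⟨x, hx, y, hy, rfl⟩ := Subgroup.mem_sup_of_normal_left.1 hg
    have hax : ⁅a, x⁆ = 1 :=
      commutatorElement_eq_one_iff_mul_comm.2
        ((Subgroup.mem_centralizer_iff.1 (hAP (iterComm_le hA hR n ha)) x hx).symm)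
    rw [commutatorElement_mul_right_eq_mul_conj, hax]
    have hc : ⁅iterComm A R n, R⁆.Normal := Subgroup.commutator_normal _ _
    have := hc.conj_mem _ (Subgroup.commutator_mem_commutator ha hy) x
    simpa [iterComm] using this

theorem HasOliverSeries.sup {p k : ℕ} {P R : Subgroup S} (hP : HasOliverSeries p k P)
    (hR : HasOliverSeries p k R) : HasOliverSeries p k (P ⊔ R) := by
  obtain ⟨n, Q, h0, rfl, hN, hs⟩ := hR
  have hPn := hP.normal
  have key : ∀ i ≤ n, HasOliverSeries p k (P ⊔ Q i) := by
    intro i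
    induction i with
    | zero => intro _; simpa [h0] using hP
    | succ i ih =>
      intro hi
      have hQi := hN i (by omega)
      have hQj := hN (i + 1) hi
      refine (ih (by omega)).extend (Subgroup.sup_normal _ _)
        (sup_le_sup_left (hs i (by omega)).1.le P) (eq_bot_iff.2 ?_)
      rw [← (hs i (by omega)).2]
      have hcn : (Subgroup.centralizer ((P ⊔ Q i : Subgroup S) : Set S)).Normal := inferInstance
      refine (iterComm_sup_le (omegaOne_normal p hcn) hPn hQj
        ((omegaOne_le p _).trans (Subgroup.centralizer_le ?_)) _).trans
        (iterComm_mono (omegaOne_mono p (Subgroup.centralizer_le ?_)) _ _)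
      · exact (le_sup_left : P ≤ P ⊔ Q i)
      · exact (le_sup_right : Q i ≤ P ⊔ Q i)
  exact key n le_rfl

/-- `oliver p k S` is the largest subgroup with a series as above. -/
theorem isGreatest_oliver (p k : ℕ) (S : Type*) [Group S] [Finite S] :
    IsGreatest {X : Subgroup S | HasOliverSeries p k X} (oliver p k S) := by
  obtain ⟨M, hM, hmax⟩ := (Set.toFinite {X : Subgroup S | HasOliverSeries p k X}).exists_maximal
    ⟨⊥, HasOliverSeries.bot p k⟩
  have hg : IsGreatest {X : Subgroup S | HasOliverSeries p k X} M :=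
    ⟨hM, fun R hR => le_sup_right.trans
      (hmax (show HasOliverSeries p k (M ⊔ R) from hM.sup hR) le_sup_left)⟩
  have : oliver p k S = M := hg.isLUB.sSup_eq
  rwa [this]

/-- `Ω₁Z(X)`, as a subgroup of `S`. -/
def omegaCenter (p : ℕ) (X : Subgroup S) : Subgroup S :=
  omegaOne p ((Subgroup.center X).map X.subtype)

theorem omegaCenter_comm (p : ℕ) {X : Subgroup S} {v x : S} (hv : v ∈ omegaCenter p X)
    (hx : x ∈ X) : x * v = v * x := by
  obtain ⟨z, hz, rfl⟩ := omegaOne_le p _ hv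
  exact congrArg Subtype.val (Subgroup.mem_center_iff.1 hz ⟨x, hx⟩)

theorem omegaCenter_le (p : ℕ) (X : Subgroup S) : omegaCenter p X ≤ X :=
  (omegaOne_le p _).trans (Subgroup.map_subtype_le _)

instance omegaCenter_normal (p : ℕ) (X : Subgroup S) [X.Normal] : (omegaCenter p X).Normal :=
  omegaOne_normal p inferInstance

instance omegaCenterCommGroup (p : ℕ) (X : Subgroup S) : CommGroup (omegaCenter p X) :=
  { (inferInstance : Group (omegaCenter p X)) with
    mul_comm := fun a b =>
      Subtype.ext (omegaCenter_comm p b.2 (omegaCenter_le p X a.2)) }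

theorem omegaCenter_pow (p : ℕ) {X : Subgroup S} {v : S} (hv : v ∈ omegaCenter p X) :
    v ^ p = 1 := by
  have hv' := hv
  unfold omegaCenter omegaOne at hv'
  induction hv' using Subgroup.closure_induction with
  | mem x hx => exact hx.2
  | one => simp
  | mul x y hx hy ihx ihy =>
    have : Commute x y := omegaCenter_comm p hy (omegaCenter_le p X hx)
    rw [this.mul_pow, ihx hx, ihy hy, one_mul]
  | inv x hx ih => rw [inv_pow, ih hx, inv_one]

/-- `V = Ω₁Z(X)`, written additively, is a vector space over `𝔽_p`. -/
instance omegaCenterModule (p : ℕ) (X : Subgroup S) :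
    Module (ZMod p) (Additive (omegaCenter p X)) :=
  AddCommGroup.zmodModule fun v => Subtype.ext (omegaCenter_pow p v.toMul.2)

/-- Conjugation by `S` on `V = Ω₁Z(X)`, as `𝔽_p`-linear maps: `g` sends `v` to `g v g⁻¹`. -/
def conjRep (p : ℕ) (X : Subgroup S) [X.Normal] :
    Representation (ZMod p) S (Additive (omegaCenter p X)) where
  toFun g := (MonoidHom.toAdditive
    (MulAut.conjNormal (H := omegaCenter p X) g).toMonoidHom).toZModLinearMap p
  map_one' := by ext v; simp
  map_mul' g h := by ext v; simp

/-- The action of `S ⧸ X` on `V = Ω₁Z(X)` induced by conjugation. -/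
def quotientRep (p : ℕ) (X : Subgroup S) [X.Normal] :
    Representation (ZMod p) (S ⧸ X) (Additive (omegaCenter p X)) :=
  QuotientGroup.lift X (conjRep p X) fun x hx => by
    refine LinearMap.ext fun v => ?_
    change MulAut.conjNormal (H := omegaCenter p X) x v.toMul = v.toMul
    apply Subtype.ext
    rw [MulAut.conjNormal_apply, omegaCenter_comm p v.toMul.2 hx, mul_inv_cancel_right]

/-- `g` is a quadratic element: its minimal polynomial on the module has degree `2`. -/
def IsQuadratic {F G V : Type*} [Field F] [Group G] [AddCommGroup V] [Module F V]
    (ρ : Representation F G V) (g : G) : Prop :=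
  (minpoly F (ρ g)).natDegree = 2

/-- `[H, x]`: the subgroup generated by the commutators of elements of `H` with `x`. -/
def commElem (H : Subgroup S) (x : S) : Subgroup S :=
  Subgroup.closure {c | ∃ h ∈ H, c = ⁅h, x⁆}

end OliverGroup

/-! Write `X` for the Oliver subgroup. Its maximality gives `C_S(X) ≤ X` and then `C_S(V) ≤ X`, so
the action is faithful (`quotientRep_injective`). An elementary abelian `A` of maximum order outside
`X` therefore does not centralize `V`. A replacement argument
(`exists_quadratic_of_not_le_centralizer`) gives `b ∈ A` that centralizes `[V, A]` but not `V`, and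
its image in `G` is quadratic. For odd `p`, a nontrivial commutator `[x, a]` of a quadratic `a` is
again quadratic if it commutes with `a` and `x` (`IsSquareZero.commutator`). This closure property
yields an abelian normal subgroup `N` of `G` containing a quadratic element
(`exists_isAbelianNormalIn_top`). Choose a quadratic `a ∈ N` with `W = ⟨a^G⟩` of least order. If
`[W, x] ≠ 1 = [W, x, x]`, some conjugate `b` of `a` gives a quadratic `[x, b] ∈ [W, G]`, and `[W, G]
< W` by nilpotency, against minimality. -/

namespace OliverGroup

/-! ### Quadratic elements and their commutators -/

section Quadratic

/-- With `N = a - 1` and `D = d - 1`, comparing the hypotheses for `a` and `d * a` gives `D * (D + 2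
* N * d) = 0`, whence `N * D ^ 2 = 0` and `D ^ 3 = 0`. The hypothesis on `d ^ 2 * a` gives the same
relation for `d ^ 2`. -/
theorem eight_mul_sq_sub_one_eq_zero {R : Type*} [CommRing R] {a d : R}
    (h0 : (a - 1) ^ 2 = 0) (h1 : (d * a - 1) ^ 2 = 0) (h3 : (d ^ 2 * a - 1) ^ 2 = 0) :
    8 * (d - 1) ^ 2 = 0 := by
  have e1 : (d - 1) * ((d - 1) + 2 * (a - 1) * d) = 0 := by
    linear_combination h1 - d ^ 2 * h0
  have e2 : (d ^ 2 - 1) * ((d ^ 2 - 1) + 2 * (a - 1) * d ^ 2) = 0 := by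
    linear_combination h3 - d ^ 4 * h0
  have e3 : (a - 1) * (d - 1) ^ 2 = 0 := by
    linear_combination (a - 1) * e1 - 2 * d * (d - 1) * h0
  have e4 : (d - 1) ^ 3 = 0 := by
    linear_combination (d - 1) * e1 - 2 * d * e3
  -- The factor `d + 1 = D + 2` is cancelled by `(D ^ 2 - 2 * D + 4) * (D + 2) = D ^ 3 + 8`, at the
  -- cost of the constant 8.
  have e5 : 8 * ((d - 1) * ((d ^ 2 - 1) + 2 * (a - 1) * d ^ 2)) = 0 := by
    linear_combination ((d - 1) ^ 2 - 2 * (d - 1) + 4) * e2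
      - (d - 1) * ((d ^ 2 - 1) + 2 * (a - 1) * d ^ 2) * e4
  linear_combination e5 - 8 * d * e1

theorem sq_sub_one_eq_zero_of_commute {R : Type*} [Ring R] (h2 : IsUnit (2 : R)) {a d : R}
    (hc : Commute a d)
    (h0 : (a - 1) ^ 2 = 0) (h1 : (d * a - 1) ^ 2 = 0) (h3 : (d ^ 2 * a - 1) ^ 2 = 0) :
    (d - 1) ^ 2 = 0 := by
  have hcomm : ∀ x ∈ ({a, d} : Set R), ∀ y ∈ ({a, d} : Set R), x * y = y * x := by
    rintro x (rfl | rfl) y (rfl | rfl)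
    exacts [rfl, hc, hc.symm, rfl]
  have := Subring.isMulCommutative_closure hcomm
  let _ : CommRing (Subring.closure {a, d}) := { mul_comm := mul_comm' }
  let a' : Subring.closure {a, d} := ⟨a, Subring.subset_closure (by simp)⟩
  let d' : Subring.closure {a, d} := ⟨d, Subring.subset_closure (by simp)⟩
  have key := eight_mul_sq_sub_one_eq_zero (a := a') (d := d')
    (Subtype.ext h0) (Subtype.ext h1) (Subtype.ext h3)
  have key' : (8 : R) * (d - 1) ^ 2 = 0 := congrArg Subtype.val key
  have h8 : IsUnit (8 : R) := by
    have := h2.pow 3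
    norm_num at this
    exact this
  exact h8.mul_right_eq_zero.1 key'

/-- `g` acts nontrivially with `(g - 1) ^ 2 = 0`. -/
def IsSquareZero {G R : Type*} [Group G] [Ring R] (ρ : G →* R) (g : G) : Prop :=
  g ≠ 1 ∧ (ρ g - 1) ^ 2 = 0

variable {G R : Type*} [Group G] [Ring R] {ρ : G →* R}

theorem IsSquareZero.conj {a : G} (ha : IsSquareZero ρ a) (g : G) :
    IsSquareZero ρ (g * a * g⁻¹) := by
  refine ⟨by simpa using ha.1, ?_⟩
  have h1 : ρ g * ρ g⁻¹ = 1 := by rw [← map_mul]; simp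
  have h2 : ρ g⁻¹ * ρ g = 1 := by rw [← map_mul]; simp
  have : ρ (g * a * g⁻¹) - 1 = ρ g * (ρ a - 1) * ρ g⁻¹ := by
    rw [map_mul, map_mul, mul_sub, sub_mul, mul_one, h1]
  rw [this, sq]
  calc ρ g * (ρ a - 1) * ρ g⁻¹ * (ρ g * (ρ a - 1) * ρ g⁻¹)
      = ρ g * (ρ a - 1) * (ρ g⁻¹ * ρ g) * (ρ a - 1) * ρ g⁻¹ := by simp only [mul_assoc]
    _ = ρ g * (ρ a - 1) ^ 2 * ρ g⁻¹ := by rw [h2, sq]; simp only [mul_assoc, mul_one]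
    _ = 0 := by rw [ha.2]; simp

/-- With `d = ⁅x, a⁆`, the conjugates of `a` by `x` and `x ^ 2` are `d * a` and `d ^ 2 * a`, and
conjugates of `a` are square-zero. -/
theorem IsSquareZero.commutator (h2 : IsUnit (2 : R)) {a x : G} (ha : IsSquareZero ρ a)
    (hca : Commute ⁅x, a⁆ a) (hcx : Commute ⁅x, a⁆ x) (h1 : ⁅x, a⁆ ≠ 1) :
    IsSquareZero ρ ⁅x, a⁆ := by
  have e1 : x * a * x⁻¹ = ⁅x, a⁆ * a := by simp [commutatorElement_def, mul_assoc]
  have e2 : x ^ 2 * a * (x ^ 2)⁻¹ = ⁅x, a⁆ ^ 2 * a := by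
    have : x ^ 2 * a * (x ^ 2)⁻¹ = x * (x * a * x⁻¹) * x⁻¹ := by simp [sq, mul_assoc]
    rw [this, e1, ← mul_assoc, ← hcx.eq, mul_assoc, mul_assoc, ← mul_assoc x, e1, sq, mul_assoc]
  refine ⟨h1, sq_sub_one_eq_zero_of_commute h2 (hca.symm.map ρ) ha.2 ?_ ?_⟩
  · rw [← map_mul, ← e1]; exact (ha.conj x).2
  · rw [← map_pow, ← map_mul, ← e2]; exact (ha.conj _).2

end Quadratic

/-! ### Abelian normal subgroups containing an element with a commutator-closed property -/

section Abstract

variable {G : Type*} [Group G]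

theorem eq_bot_of_le_commutator [Group.IsNilpotent G] {H : Subgroup G}
    (h : H ≤ ⁅H, (⊤ : Subgroup G)⁆) : H = ⊥ := by
  obtain ⟨n, hn⟩ := Subgroup.nilpotent_iff_lowerCentralSeries.1 (inferInstance : Group.IsNilpotent G)
  have : ∀ m, H ≤ (⊤ : Subgroup G).lowerCentralSeries m := by
    intro m
    induction m with
    | zero => simp
    | succ m ih => exact h.trans (Subgroup.commutator_mono ih le_rfl)
  exact eq_bot_iff.2 ((this n).trans hn.le)

/-- `A` is an abelian subgroup of `M`, normalised by `M` and containing an element that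
satisfies `Q`. -/
structure IsAbelianNormalIn (Q : G → Prop) (M A : Subgroup G) : Prop where
  le : A ≤ M
  conj : ∀ m ∈ M, ∀ x ∈ A, m * x * m⁻¹ ∈ A
  comm : ∀ x ∈ A, ∀ y ∈ A, x * y = y * x
  ex : ∃ x ∈ A, Q x

theorem IsAbelianNormalIn.of_closure {Q : G → Prop} {M : Subgroup G} {T : Set G}
    (hQ : ∀ x ∈ T, Q x) (hM : T ⊆ M) (hconj : ∀ m ∈ M, ∀ x ∈ T, m * x * m⁻¹ ∈ T)
    (hcomm : ∀ x ∈ T, ∀ y ∈ T, x * y = y * x) (hne : T.Nonempty) :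
    IsAbelianNormalIn Q M (Subgroup.closure T) where
  le := (Subgroup.closure_le _).2 hM
  conj m hm x hx := by
    have : Subgroup.closure T ≤ (Subgroup.closure T).comap (MulAut.conj m).toMonoidHom :=
      (Subgroup.closure_le _).2 fun y hy => Subgroup.subset_closure (hconj m hm y hy)
    exact this hx
  comm x hx y hy := by
    have := Subgroup.isMulCommutative_closure hcomm
    exact congrArg Subtype.val (mul_comm' (⟨x, hx⟩ : Subgroup.closure T) ⟨y, hy⟩)
  ex := by
    obtain ⟨x, hx⟩ := hne
    exact ⟨x, Subgroup.subset_closure hx, hQ x hx⟩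

-- The two properties of quadratic elements on which the group-theoretic argument rests; `Q` becomes
-- `IsSquareZero ρ`.
variable {Q : G → Prop} (hQc : ∀ x g, Q x → Q (g * x * g⁻¹))
  (hQm : ∀ a x, Q a → Commute ⁅x, a⁆ a → Commute ⁅x, a⁆ x → ⁅x, a⁆ ≠ 1 → Q ⁅x, a⁆)

-- Take `A` minimal. The `Q`-elements of `A` and all their conjugates under the normalizer of `M`
-- turn out to commute, so they generate the required subgroup.
include hQc hQm in
theorem IsAbelianNormalIn.normalizer [Finite G] {M A : Subgroup G} (hA : IsAbelianNormalIn Q M A) :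
    ∃ B, IsAbelianNormalIn Q (Subgroup.normalizer (M : Set G)) B := by
  obtain ⟨A, hA, hmin⟩ := (Set.toFinite {A | IsAbelianNormalIn Q M A}).exists_minimal ⟨A, hA⟩
  have hA : IsAbelianNormalIn Q M A := hA
  have hN : ∀ g ∈ Subgroup.normalizer (M : Set G), ∀ x ∈ M, g * x * g⁻¹ ∈ M := fun g hg x hx =>
    (Subgroup.mem_normalizer_iff.1 hg x).1 hx
  have key : ∀ g ∈ Subgroup.normalizer (M : Set G), ∀ x ∈ A, Q x → ∀ y ∈ A, Q y →
      x * (g * y * g⁻¹) = g * y * g⁻¹ * x := by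
    intro g hg x hx hQx y hy hQy
    by_contra hne
    set z := g * y * g⁻¹ with hz
    have hy' : y = g⁻¹ * z * g := by simp [hz, mul_assoc]
    have hzM : z ∈ M := hN g hg y (hA.le hy)
    -- The commutator lies in both `A` and `g A g⁻¹`, being formed from `x ∈ A` and `z ∈ g A g⁻¹`,
    -- each subgroup being normalised by `M`. So it commutes with `x` and with `z`, and satisfies
    -- `Q`.
    have huA : ⁅z, x⁆ ∈ A := A.mul_mem (hA.conj z hzM x hx) (A.inv_mem hx)
    have hx' : g⁻¹ * x * g ∈ M := by
      simpa using hN g⁻¹ (Subgroup.inv_mem _ hg) x (hA.le hx)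
    have hu' : g⁻¹ * ⁅z, x⁆ * g ∈ A := by
      have : g⁻¹ * ⁅z, x⁆ * g = y * ((g⁻¹ * x * g) * y⁻¹ * (g⁻¹ * x * g)⁻¹) := by
        rw [hy']; simp [commutatorElement_def, mul_assoc]
      rw [this]
      exact A.mul_mem hy (hA.conj _ hx' _ (A.inv_mem hy))
    have hu1 : ⁅z, x⁆ ≠ 1 := fun h => hne (commutatorElement_eq_one_iff_mul_comm.1 h).symm
    have hux : Commute ⁅z, x⁆ x := hA.comm _ huA _ hx
    have huz : Commute ⁅z, x⁆ z := by
      have h := hA.comm _ hu' _ hy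
      rw [hy'] at h
      have h' := congrArg (fun t => g * t * g⁻¹) h
      simpa [mul_assoc, Commute, SemiconjBy] using h'
    have hQu := hQm x z hQx hux huz hu1
    have hB : IsAbelianNormalIn Q M (Subgroup.closure {t | Q t ∧ t ∈ A ∧ g⁻¹ * t * g ∈ A}) := by
      refine IsAbelianNormalIn.of_closure (fun t ht => ht.1) (fun t ht => hA.le ht.2.1) ?_
        (fun s hs t ht => hA.comm s hs.2.1 t ht.2.1) ⟨_, hQu, huA, hu'⟩
      rintro m hm t ⟨h1, h2, h3⟩
      refine ⟨hQc t m h1, hA.conj m hm t h2, ?_⟩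
      have : g⁻¹ * (m * t * m⁻¹) * g
          = (g⁻¹ * m * g) * (g⁻¹ * t * g) * (g⁻¹ * m * g)⁻¹ := by simp [mul_assoc]
      rw [this]
      refine hA.conj _ ?_ _ h3
      simpa using hN g⁻¹ (Subgroup.inv_mem _ hg) m hm
    have hBA : Subgroup.closure {t | Q t ∧ t ∈ A ∧ g⁻¹ * t * g ∈ A} ≤ A :=
      (Subgroup.closure_le _).2 fun t ht => ht.2.1
    -- Minimality forces `A ≤ g A g⁻¹`, so `x` and `z` lie in one abelian group: a contradiction.
    have hAB := hmin hB hBA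
    have hle : A ≤ A.comap (MulAut.conj g⁻¹).toMonoidHom := by
      refine le_trans hAB ((Subgroup.closure_le _).2 fun t ht => ?_)
      simpa using ht.2.2
    have hx2 : g⁻¹ * x * g ∈ A := by simpa using hle hx
    have h := hA.comm _ hx2 _ hy
    rw [hy'] at h
    have h' := congrArg (fun t => g * t * g⁻¹) h
    exact hne (by simpa [mul_assoc] using h')
  obtain ⟨x₀, hx₀, hQ₀⟩ := hA.ex
  refine ⟨_, IsAbelianNormalIn.of_closure (T := {t | ∃ g ∈ Subgroup.normalizer (M : Set G), ∃ y ∈ A, Q y ∧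
    t = g * y * g⁻¹}) ?_ ?_ ?_ ?_ ⟨x₀, 1, Subgroup.one_mem _, x₀, hx₀, hQ₀, by simp⟩⟩
  · rintro _ ⟨g, -, y, -, hy, rfl⟩
    exact hQc y g hy
  · rintro _ ⟨g, hg, y, hyA, hy, rfl⟩
    exact Subgroup.le_normalizer (hN g hg y (hA.le hyA))
  · rintro m hm _ ⟨g, hg, y, hyA, hy, rfl⟩
    exact ⟨m * g, Subgroup.mul_mem _ hm hg, y, hyA, hy, by simp [mul_assoc]⟩
  · rintro _ ⟨g, hg, x, hx, hQx, rfl⟩ _ ⟨h, hh, y, hy, hQy, rfl⟩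
    have := key (g⁻¹ * h) (Subgroup.mul_mem _ (Subgroup.inv_mem _ hg) hh) x hx hQx y hy hQy
    have h' := congrArg (fun t => g * t * g⁻¹) this
    simpa [mul_assoc] using h'

-- A maximal `M` having such a subgroup is self-normalizing, hence is all of the nilpotent group
-- `G`.
include hQc hQm in
theorem exists_isAbelianNormalIn_top [Finite G] [Group.IsNilpotent G] {a : G} (ha : Q a) :
    ∃ A, IsAbelianNormalIn Q (⊤ : Subgroup G) A := by
  have h0 : IsAbelianNormalIn Q (Subgroup.zpowers a) (Subgroup.closure {a}) := by
    refine IsAbelianNormalIn.of_closure (by simpa using ha) (by simp) ?_ (by simp) ⟨a, rfl⟩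
    rintro m ⟨n, rfl⟩ x rfl
    simpa using (Commute.zpow_self x n).mul_inv_cancel
  obtain ⟨M, ⟨A, hA⟩, hmax⟩ :=
    (Set.toFinite {M : Subgroup G | ∃ A, IsAbelianNormalIn Q M A}).exists_maximal ⟨_, _, h0⟩
  have hle := hmax (hA.normalizer hQc hQm) Subgroup.le_normalizer
  have hM : M = ⊤ := by
    by_contra hM
    exact (Group.normalizerCondition_of_isNilpotent M (lt_top_iff_ne_top.2 hM)).not_ge hle
  exact ⟨A, hM ▸ hA⟩

include hQc hQm in
theorem exists_commElem_ne_bot [Finite G] [Group.IsNilpotent G]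
    (hQ1 : ∀ x, Q x → x ≠ 1) (hex : ∃ a, Q a) :
    ∃ a, Q a ∧ (∀ x ∈ Subgroup.normalClosure {a}, ∀ y ∈ Subgroup.normalClosure {a},
        x * y = y * x) ∧
      ∀ x, commElem (Subgroup.normalClosure {a}) x = ⊥ ∨
        commElem (commElem (Subgroup.normalClosure {a}) x) x ≠ ⊥ := by
  obtain ⟨a₀, ha₀⟩ := hex
  obtain ⟨N, hN⟩ := exists_isAbelianNormalIn_top hQc hQm ha₀
  have hNn : N.Normal := ⟨fun x hx g => hN.conj g trivial x hx⟩
  obtain ⟨a, ⟨haN, ha⟩, hmin⟩ := Set.exists_min_image {a : G | a ∈ N ∧ Q a}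
    (fun a => Nat.card (Subgroup.normalClosure {a})) (Set.toFinite _) hN.ex
  have hWN : Subgroup.normalClosure {a} ≤ N :=
    Subgroup.normalClosure_le_normal (by simpa using haN)
  have hcomm : ∀ x ∈ Subgroup.normalClosure {a}, ∀ y ∈ Subgroup.normalClosure {a},
      x * y = y * x := fun x hx y hy => hN.comm x (hWN hx) y (hWN hy)
  refine ⟨a, ha, hcomm, fun x => ?_⟩
  by_contra! hcon
  obtain ⟨h1, h2⟩ := hcon
  set W := Subgroup.normalClosure {a} with hW
  have hWnormal : W.Normal := Subgroup.normalClosure_normal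
  -- If `x` centralized every conjugate of `a`, it would centralize `W`.
  obtain ⟨g, hg⟩ : ∃ g, ⁅g * a * g⁻¹, x⁆ ≠ 1 := by
    by_contra! hall
    refine h1 (eq_bot_iff.2 ((Subgroup.closure_le _).2 ?_))
    have hle : W ≤ Subgroup.centralizer {x} := by
      refine (Subgroup.closure_le _).2 fun y hy => ?_
      obtain ⟨z, hz, hzy⟩ := Group.mem_conjugatesOfSet_iff.1 hy
      obtain rfl : z = a := hz
      obtain ⟨g, rfl⟩ := isConj_iff.1 hzy
      exact Subgroup.mem_centralizer_singleton_iff.2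
        (commutatorElement_eq_one_iff_mul_comm.1 (hall g))
    rintro _ ⟨h, hh, rfl⟩
    exact commutatorElement_eq_one_iff_mul_comm.2
      (Subgroup.mem_centralizer_singleton_iff.1 (hle hh))
  set b := g * a * g⁻¹ with hb
  have haW : a ∈ W := Subgroup.subset_normalClosure rfl
  have hbW : b ∈ W := hWnormal.conj_mem a haW g
  have hinv : ⁅x, b⁆ = ⁅b, x⁆⁻¹ := (commutatorElement_inv b x).symm
  have hcW : ⁅x, b⁆ ∈ W := W.mul_mem (hWnormal.conj_mem b hbW x) (W.inv_mem hbW)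
  have hcx : Commute ⁅x, b⁆ x := by
    rw [hinv]
    -- Here `[W, x, x] = 1` is used; commuting with `b` comes from `W` being abelian.
    refine Commute.inv_left (commutatorElement_eq_one_iff_mul_comm.1 ?_)
    have : ⁅⁅b, x⁆, x⁆ ∈ commElem (commElem W x) x :=
      Subgroup.subset_closure ⟨_, Subgroup.subset_closure ⟨b, hbW, rfl⟩, rfl⟩
    rwa [h2, Subgroup.mem_bot] at this
  have hQu : Q ⁅x, b⁆ := hQm b x (hQc a g ha) (hcomm _ hcW _ hbW) hcx
    (by rw [hinv]; exact inv_ne_one.2 hg)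
  have hle : Subgroup.normalClosure {⁅x, b⁆} ≤ ⁅W, (⊤ : Subgroup G)⁆ := by
    refine Subgroup.normalClosure_le_normal ?_
    rw [Set.singleton_subset_iff, hinv]
    exact Subgroup.inv_mem _ (Subgroup.commutator_mem_commutator hbW trivial)
  have hle2 : ⁅W, (⊤ : Subgroup G)⁆ ≤ W := Subgroup.commutator_le_left _ _
  have heq := Subgroup.eq_of_le_of_card_ge (hle.trans hle2) (hmin _ ⟨hWN hcW, hQu⟩)
  have hbot := eq_bot_of_le_commutator (heq.ge.trans hle)
  rw [hbot, Subgroup.mem_bot] at haW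
  exact hQ1 a ha haW

end Abstract
-- A replacement theorem for elementary abelian subgroups of maximum order
section Replacement

variable {S : Type*} [Group S]

theorem IsElemAb.sup {p : ℕ} {A B : Subgroup S} (hA : IsElemAb p A) (hB : IsElemAb p B)
    (hAB : ∀ x ∈ A, ∀ y ∈ B, x * y = y * x) : IsElemAb p (A ⊔ B) := by
  have hle : ∀ x ∈ A ⊔ B, ∃ y ∈ A, ∃ z ∈ B, y * z = x := by
    intro x hx
    have hn : A ≤ Subgroup.normalizer (B : Set S) := fun a ha => by
      refine Subgroup.mem_normalizer_iff.2 fun b => ⟨fun hb => ?_, fun hb => ?_⟩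
      · rw [hAB a ha b hb, mul_inv_cancel_right]; exact hb
      · have := hAB a ha _ hb
        have h2 : b = a * b * a⁻¹ := by
          have h3 : a * b * a⁻¹ = a⁻¹ * (a * (a * b * a⁻¹)) := by group
          rw [h3, this]; group
        rw [h2]; exact hb
    have hx' : x ∈ ((A ⊔ B : Subgroup S) : Set S) := hx
    rw [Subgroup.coe_mul_of_left_le_normalizer_right _ _ hn] at hx'
    exact Set.mem_mul.1 hx'
  constructor
  · intro x hx y hy
    obtain ⟨a, ha, b, hb, rfl⟩ := hle x hx
    obtain ⟨c, hc, d, hd, rfl⟩ := hle y hy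
    have h1 : Commute a c := hA.1 a ha c hc
    have h2 : Commute b d := hB.1 b hb d hd
    have h3 : Commute a d := hAB a ha d hd
    have h4 : Commute c b := hAB c hc b hb
    exact (h1.mul_right h3).mul_left (h4.symm.mul_right h2)
  · intro x hx
    obtain ⟨a, ha, b, hb, rfl⟩ := hle x hx
    rw [(show Commute a b from hAB a ha b hb).mul_pow, hA.2 a ha, hB.2 b hb, one_mul]

theorem IsElemAb.mono {p : ℕ} {A B : Subgroup S} (hB : IsElemAb p B) (h : A ≤ B) : IsElemAb p A :=
  ⟨fun x hx y hy => hB.1 x (h hx) y (h hy), fun x hx => hB.2 x (h hx)⟩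

variable [Finite S]

theorem card_mul_card_le (H K : Subgroup S) :
    Nat.card H * Nat.card K ≤ Nat.card (H ⊔ K : Subgroup S) * Nat.card (H ⊓ K : Subgroup S) := by
  have h1 : Nat.card (H ⊓ K : Subgroup S) * K.relIndex H = Nat.card H := by
    have := Subgroup.relIndex_mul_relIndex ⊥ (H ⊓ K) H bot_le inf_le_left
    rwa [Subgroup.relIndex_bot_left, Subgroup.relIndex_bot_left, Subgroup.inf_relIndex_left] at this
  have h2 : Nat.card K * K.relIndex (H ⊔ K) = Nat.card (H ⊔ K : Subgroup S) := by
    have := Subgroup.relIndex_mul_relIndex ⊥ K (H ⊔ K) bot_le le_sup_right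
    rwa [Subgroup.relIndex_bot_left, Subgroup.relIndex_bot_left] at this
  have h3 : K.relIndex H ≤ K.relIndex (H ⊔ K) :=
    Subgroup.relIndex_le_of_le_right le_sup_left Subgroup.FiniteIndex.index_ne_zero
  rw [← h1, ← h2]
  nlinarith [Nat.mul_le_mul_left (Nat.card (H ⊓ K : Subgroup S) * Nat.card K) h3]

/-- The order of `U` times the order of its centralizer in `A`. -/
noncomputable def offenderCard (A U : Subgroup S) : ℕ :=
  Nat.card U * Nat.card (A ⊓ Subgroup.centralizer (U : Set S) : Subgroup S)

/-- This is the Chermak–Delgado inequality: `C_A(U)` and `C_A(U')` generate a subgroup of `C_A(U ⊓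
U')` and meet inside `C_A(U ⊔ U')`. -/
theorem offenderCard_mul_le (A U U' : Subgroup S) :
    offenderCard A U * offenderCard A U' ≤ offenderCard A (U ⊔ U') * offenderCard A (U ⊓ U') := by
  unfold offenderCard
  have h1 := card_mul_card_le U U'
  set C := A ⊓ Subgroup.centralizer (U : Set S)
  set C' := A ⊓ Subgroup.centralizer (U' : Set S)
  have h2 := card_mul_card_le C C'
  have h3 : C ⊔ C' ≤ A ⊓ Subgroup.centralizer ((U ⊓ U' : Subgroup S) : Set S) :=
    sup_le (inf_le_inf_left A (Subgroup.centralizer_le (inf_le_left : U ⊓ U' ≤ U)))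
      (inf_le_inf_left A (Subgroup.centralizer_le (inf_le_right : U ⊓ U' ≤ U')))
  have h4 : C ⊓ C' ≤ A ⊓ Subgroup.centralizer ((U ⊔ U' : Subgroup S) : Set S) := by
    refine le_inf (inf_le_left.trans inf_le_left) (Subgroup.le_centralizer_iff.2 (sup_le ?_ ?_))
    · exact Subgroup.le_centralizer_iff.2 (inf_le_left.trans inf_le_right)
    · exact Subgroup.le_centralizer_iff.2 (inf_le_right.trans inf_le_right)
  have h3' := Subgroup.card_le_of_le h3
  have h4' := Subgroup.card_le_of_le h4
  calc _ = (Nat.card U * Nat.card U') * (Nat.card C * Nat.card C') := by ring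
    _ ≤ _ := Nat.mul_le_mul h1 (h2.trans (Nat.mul_le_mul h3' h4'))
    _ = _ := by ring

variable {p : ℕ} {A V : Subgroup S}

/-- `U` and `C_A(U)` generate an elementary abelian group, so its order is at most that of `A`; they
meet inside `V ⊓ A`. -/
theorem offenderCard_le (hA : IsElemAb p A)
    (hmax : ∀ B : Subgroup S, IsElemAb p B → Nat.card B ≤ Nat.card A) (hV : IsElemAb p V)
    {U : Subgroup S} (hU : U ≤ V) :
    offenderCard A U ≤ Nat.card A * Nat.card (V ⊓ A : Subgroup S) := by
  refine (card_mul_card_le _ _).trans (Nat.mul_le_mul (hmax _ ?_) (Subgroup.card_le_of_le ?_))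
  · refine (hV.mono hU).sup (hA.mono inf_le_left) fun x hx y hy => ?_
    exact Subgroup.mem_centralizer_iff.1 hy.2 x hx
  · exact inf_le_inf hU inf_le_left

/-- The subgroups `[v, A] (V ⊓ A)` attain the upper bound of `offenderCard_le`: with `U` this
subgroup, `a ↦ ⁅v, a⁆` induces an injection from `A / C_A(U)` to `U / (V ⊓ A)`. -/
theorem le_offenderCard (hA : IsElemAb p A) (hV : IsElemAb p V) [V.Normal] {v : S} (hv : v ∈ V) :
    Nat.card A * Nat.card (V ⊓ A : Subgroup S) ≤
      offenderCard A (Subgroup.closure {c | ∃ a ∈ A, c = ⁅v, a⁆} ⊔ V ⊓ A) := by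
  set W := V ⊓ A with hW
  set U := Subgroup.closure {c | ∃ a ∈ A, c = ⁅v, a⁆} ⊔ W with hU
  set C := A ⊓ Subgroup.centralizer (U : Set S) with hC
  have hmem : ∀ a : A, ⁅v, (a : S)⁆ ∈ U := fun a =>
    Subgroup.mem_sup_left (Subgroup.subset_closure ⟨a, a.2, rfl⟩)
  let f : A → U := fun a => ⟨⁅v, (a : S)⁆, hmem a⟩
  have hVmem : ∀ a : S, ⁅v, a⁆ ∈ V := fun a => by
    rw [commutatorElement_def, mul_assoc, mul_assoc, ← mul_assoc a]
    exact V.mul_mem hv (Subgroup.Normal.conj_mem inferInstance _ (V.inv_mem hv) a)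
  have hf : ∀ a b : A, (f a)⁻¹ * f b ∈ W.subgroupOf U → a⁻¹ * b ∈ C.subgroupOf A := by
    intro a b h
    rw [Subgroup.mem_subgroupOf] at h ⊢
    have h : ⁅v, (a : S)⁆⁻¹ * ⁅v, (b : S)⁆ ∈ W := h
    change (a : S)⁻¹ * b ∈ C
    set w := ⁅v, (a : S)⁆⁻¹ * ⁅v, (b : S)⁆ with hw
    set c := (a : S)⁻¹ * b with hc
    have hcA : c ∈ A := A.mul_mem (A.inv_mem a.2) b.2
    have hwc : ⁅v, c⁆ = w := by
      have e1 : (a : S)⁻¹ * w * a = v * (c * v⁻¹ * c⁻¹) := by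
        simp [hw, hc, commutatorElement_def, mul_assoc]
      have e2 : (a : S)⁻¹ * w * a = w := by
        rw [mul_assoc, hA.1 w h.2 a a.2, inv_mul_cancel_left]
      rw [← e2, e1]; simp [commutatorElement_def, mul_assoc]
    -- So `c` moves `v` only by an element `w` of `V ⊓ A`, which commutes with `V` and `A`; hence
    -- `c` fixes every `⁅v, d⁆`.
    have hcv : c * v * c⁻¹ = w⁻¹ * v := by
      rw [← hwc]; simp [commutatorElement_def, mul_assoc]
    refine ⟨hcA, ?_⟩
    have : U ≤ Subgroup.centralizer {c} := by
      refine sup_le ((Subgroup.closure_le _).2 ?_) fun y hy =>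
        Subgroup.mem_centralizer_singleton_iff.2 (hA.1 y hy.2 c hcA)
      rintro _ ⟨d, hd, rfl⟩
      refine Subgroup.mem_centralizer_singleton_iff.2 ?_
      have e1 : c * ⁅v, d⁆ * c⁻¹ = ⁅v, d⁆ := by
        have e2 : c * ⁅v, d⁆ * c⁻¹ = ⁅c * v * c⁻¹, c * d * c⁻¹⁆ := by
          simp [commutatorElement_def, mul_assoc]
        have e3 : c * d * c⁻¹ = d := by rw [hA.1 c hcA d hd, mul_inv_cancel_right]
        have e4 : Commute w d := hA.1 w h.2 d hd
        have e5 : Commute w ⁅v, d⁆ := hV.1 w h.1 _ (hVmem d)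
        rw [e2, e3, hcv]
        calc ⁅w⁻¹ * v, d⁆ = w⁻¹ * (v * d * v⁻¹) * (w * d⁻¹) := by
              simp [commutatorElement_def, mul_assoc]
          _ = w⁻¹ * (⁅v, d⁆ * w) := by
              rw [(e4.inv_right).eq]; simp [commutatorElement_def, mul_assoc]
          _ = ⁅v, d⁆ := by rw [← e5.eq, inv_mul_cancel_left]
      calc ⁅v, d⁆ * c = c * ⁅v, d⁆ * c⁻¹ * c := by rw [e1]
        _ = c * ⁅v, d⁆ := by simp
    exact Subgroup.mem_centralizer_iff.2 fun y hy =>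
      Subgroup.mem_centralizer_singleton_iff.1 (this hy)
  have hinj : Function.Injective (fun q : A ⧸ C.subgroupOf A =>
      (QuotientGroup.mk (f q.out) : U ⧸ W.subgroupOf U)) := by
    intro q r hqr
    have := hf _ _ (QuotientGroup.eq.1 hqr)
    rw [← QuotientGroup.out_eq' q, ← QuotientGroup.out_eq' r]
    exact QuotientGroup.eq.2 this
  have hidx : C.relIndex A ≤ W.relIndex U := Nat.card_le_card_of_injective _ hinj
  have hCA : Nat.card C * C.relIndex A = Nat.card A := by
    have := Subgroup.relIndex_mul_relIndex ⊥ C A bot_le inf_le_left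
    rwa [Subgroup.relIndex_bot_left, Subgroup.relIndex_bot_left] at this
  have hWU : Nat.card W * W.relIndex U = Nat.card U := by
    have := Subgroup.relIndex_mul_relIndex ⊥ W U bot_le le_sup_right
    rwa [Subgroup.relIndex_bot_left, Subgroup.relIndex_bot_left] at this
  unfold offenderCard
  rw [← hCA, ← hWU]
  nlinarith [Nat.mul_le_mul_left (Nat.card C * Nat.card W) hidx]

/-- An elementary abelian subgroup of maximum order that does not centralize the elementary
abelian normal subgroup `V` has an element acting quadratically and nontrivially on `V`. -/
theorem exists_quadratic_of_not_le_centralizer [Group.IsNilpotent S] (hA : IsElemAb p A)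
    (hmax : ∀ B : Subgroup S, IsElemAb p B → Nat.card B ≤ Nat.card A) (hV : IsElemAb p V)
    [V.Normal] (hAV : ¬ A ≤ Subgroup.centralizer (V : Set S)) :
    ∃ b ∈ A, b ∉ Subgroup.centralizer (V : Set S) ∧ b ∈ Subgroup.centralizer ((⁅V, A⁆ : Subgroup S) : Set S) := by
  set m := Nat.card A * Nat.card (V ⊓ A : Subgroup S) with hm
  have hm0 : 0 < m := Nat.mul_pos Nat.card_pos Nat.card_pos
  have hKV : ⁅V, A⁆ ≤ V := Subgroup.commutator_le_left _ _
  have hgen : ∀ v ∈ V, Subgroup.closure {c | ∃ a ∈ A, c = ⁅v, a⁆} ≤ ⁅V, A⁆ := fun v hv =>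
    (Subgroup.closure_le _).2 (by
      rintro _ ⟨a, ha, rfl⟩; exact Subgroup.commutator_mem_commutator hv ha)
  -- Subgroups attaining the bound `m` are closed under joins, so a maximal one contains every `[v,
  -- A]`. The choice `v = 1` shows that one exists.
  obtain ⟨U, ⟨hUT, hU⟩, hUmax⟩ := (Set.toFinite {U : Subgroup S | U ≤ ⁅V, A⁆ ⊔ V ⊓ A ∧
    m ≤ offenderCard A U}).exists_maximal
    ⟨_, sup_le_sup_right (hgen 1 V.one_mem) _, le_offenderCard hA hV V.one_mem⟩
  have hTV : ⁅V, A⁆ ⊔ V ⊓ A ≤ V := sup_le hKV inf_le_left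
  have hUle : ⁅V, A⁆ ≤ U := by
    refine Subgroup.commutator_le.2 fun v hv a ha => ?_
    set U' := Subgroup.closure {c | ∃ a ∈ A, c = ⁅v, a⁆} ⊔ V ⊓ A with hU'
    have h1 : m ≤ offenderCard A U' := le_offenderCard hA hV hv
    have h2 : offenderCard A (U ⊓ U') ≤ m :=
      offenderCard_le hA hmax hV (inf_le_left.trans (hUT.trans hTV))
    have h3 := offenderCard_mul_le A U U'
    have h4 : m ≤ offenderCard A (U ⊔ U') := by
      refine Nat.le_of_mul_le_mul_right ?_ hm0
      exact (Nat.mul_le_mul hU h1).trans (h3.trans (Nat.mul_le_mul_left _ h2))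
    have h5 : U ⊔ U' ≤ U :=
      hUmax ⟨sup_le hUT (sup_le_sup_right (hgen v hv) _), h4⟩ le_sup_left
    exact h5 (Subgroup.mem_sup_right (Subgroup.mem_sup_left
      (Subgroup.subset_closure ⟨a, ha, rfl⟩)))
  by_contra! hcon
  have hCU : A ⊓ Subgroup.centralizer (U : Set S) ≤ A ⊓ Subgroup.centralizer (V : Set S) := by
    refine le_inf inf_le_left fun b hb => ?_
    by_contra hbV
    exact hcon b hb.1 hbV (Subgroup.centralizer_le hUle hb.2)
  -- Now `C_A(U) ≤ C_A(V)`, so comparing the bound for `V` with the value at `U` gives `U = V`.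
  have hle : Nat.card V ≤ Nat.card U := by
    have h1 := (offenderCard_le hA hmax hV le_rfl).trans hU
    have h2 := h1.trans (Nat.mul_le_mul_left _ (Subgroup.card_le_of_le hCU))
    exact Nat.le_of_mul_le_mul_right h2 Nat.card_pos
  have hUV : U = V := Subgroup.eq_of_le_of_card_ge (hUT.trans hTV) hle
  have hVT : V ≤ ⁅V, A⁆ ⊔ V ⊓ A := hUV ▸ hUT
  -- `V` is generated by `[V, A]` and `V ⊓ A`, and `A` centralizes the latter, so `[V, A] = [V, A,
  -- A]`. Nilpotency then gives `[V, A] = 1`.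
  have hK : ⁅V, A⁆ ≤ ⁅⁅V, A⁆, (⊤ : Subgroup S)⁆ := by
    refine Subgroup.commutator_le.2 fun v hv a ha => ?_
    have hv' : v ∈ ((V ⊓ A) ⊔ ⁅V, A⁆ : Subgroup S) := by rw [sup_comm]; exact hVT hv
    have hn : V ⊓ A ≤ Subgroup.normalizer ((⁅V, A⁆ : Subgroup S) : Set S) := by
      intro x hx
      refine Subgroup.mem_normalizer_iff.2 fun y => ?_
      have hc : ∀ y ∈ V, x * y * x⁻¹ = y := fun y hy => by
        rw [hV.1 x hx.1 y hy, mul_inv_cancel_right]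
      refine ⟨fun hy => (hc y (hKV hy)).symm ▸ hy, fun hy => ?_⟩
      have hyV : y ∈ V := by
        have := Subgroup.Normal.conj_mem (inferInstance : V.Normal) _ (hKV hy) x⁻¹
        simpa [mul_assoc] using this
      rwa [hc y hyV] at hy
    have hv'' : v ∈ (((V ⊓ A) ⊔ ⁅V, A⁆ : Subgroup S) : Set S) := hv'
    rw [Subgroup.coe_mul_of_left_le_normalizer_right _ _ hn] at hv''
    obtain ⟨w, hw, u, hu, rfl⟩ := Set.mem_mul.1 hv''
    have e : ⁅w * u, a⁆ = ⁅u, a⁆ := by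
      have e1 : w * ⁅u, a⁆ * w⁻¹ = ⁅u, a⁆ := by
        have : ⁅u, a⁆ ∈ V := hKV (Subgroup.commutator_mem_commutator (hKV hu) ha)
        rw [hV.1 w hw.1 _ this, mul_inv_cancel_right]
      have e2 : ⁅w, a⁆ = 1 := commutatorElement_eq_one_iff_mul_comm.2 (hA.1 w hw.2 a ha)
      have e3 : ⁅w * u, a⁆ = w * ⁅u, a⁆ * w⁻¹ * ⁅w, a⁆ := by
        simp [commutatorElement_def, mul_assoc]
      rw [e3, e1, e2, mul_one]
    rw [e]
    exact Subgroup.commutator_mem_commutator hu trivial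
  have hbot := eq_bot_of_le_commutator hK
  exact hAV (Subgroup.le_centralizer_iff.1
    (Subgroup.commutator_eq_bot_iff_le_centralizer.1 hbot))

end Replacement
-- Faithfulness of the action on `V`
section Faithful

variable {S : Type*} [Group S] {p k : ℕ}

theorem iterComm_eq_bot_of_le {A B : Subgroup S} {m n : ℕ} (hmn : m ≤ n)
    (h : iterComm A B m = ⊥) : iterComm A B n = ⊥ := by
  induction n, hmn using Nat.le_induction with
  | base => exact h
  | succ n _ ih => rw [iterComm, ih, Subgroup.commutator_bot_left]

theorem exists_iterComm_top_eq_bot [Group.IsNilpotent S] (H : Subgroup S) :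
    ∃ n, iterComm H ⊤ n = ⊥ := by
  obtain ⟨n, hn⟩ := Subgroup.nilpotent_iff_lowerCentralSeries.1
    (inferInstance : Group.IsNilpotent S)
  have : ∀ m, iterComm H ⊤ m ≤ (⊤ : Subgroup S).lowerCentralSeries m := by
    intro m
    induction m with
    | zero => simp
    | succ m ih => exact Subgroup.commutator_mono ih le_rfl
  exact ⟨n, eq_bot_iff.2 ((this n).trans hn.le)⟩

theorem le_oliver_of_iterComm_eq_bot [Finite S] {R : Subgroup S} (hR : R.Normal)
    (hle : oliver p k S ≤ R)
    (h : iterComm (omegaOne p (Subgroup.centralizer (oliver p k S : Set S))) R (k - 1) = ⊥) :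
    R ≤ oliver p k S :=
  (isGreatest_oliver p k S).2 ((isGreatest_oliver p k S).1.extend hR hle h)

/-- Otherwise let `K` be the last term of `C, [C, S], [C, S, S], …` not inside `X`. Then `[Ω₁(C), K]
≤ [K, S] ≤ X` is centralized by `K ≤ C`, so `X K` extends the series. Two commutators suffice, which
is where `3 ≤ k` enters. -/
theorem centralizer_oliver_le [Finite S] [Group.IsNilpotent S] (hk : 3 ≤ k) :
    Subgroup.centralizer (oliver p k S : Set S) ≤ oliver p k S := by
  classical
  set X := oliver p k S with hX
  set C := Subgroup.centralizer (X : Set S) with hC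
  have hCn : C.Normal := inferInstance
  have hex : ∃ n, iterComm C ⊤ n ≤ X := by
    obtain ⟨n, hn⟩ := exists_iterComm_top_eq_bot C
    exact ⟨n, hn ▸ bot_le⟩
  rcases hn : Nat.find hex with _ | i
  · have h0 := Nat.find_spec hex
    rwa [hn] at h0
  exfalso
  have h1 : iterComm C ⊤ (i + 1) ≤ X := hn ▸ Nat.find_spec hex
  refine Nat.find_min hex (m := i) (by omega) ?_
  set K := iterComm C ⊤ i with hK
  have hKn : K.Normal := iterComm_normal hCn inferInstance i
  have hKC : K ≤ C := iterComm_le hCn inferInstance i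
  refine le_trans le_sup_right
    (le_oliver_of_iterComm_eq_bot (R := X ⊔ K) (Subgroup.sup_normal _ _) le_sup_left ?_)
  have hOn : (omegaOne p C).Normal := omegaOne_normal p hCn
  refine iterComm_eq_bot_of_le (show 2 ≤ k - 1 by omega) (eq_bot_iff.2 ?_)
  refine (iterComm_sup_le hOn (oliver_normal p k) hKn (omegaOne_le p _) 2).trans ?_
  have h2 : iterComm (omegaOne p C) K 1 ≤ X := by
    refine le_trans ?_ h1
    change ⁅omegaOne p C, K⁆ ≤ ⁅K, ⊤⁆
    rw [Subgroup.commutator_comm]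
    exact Subgroup.commutator_mono le_rfl le_top
  refine (Subgroup.commutator_mono h2 hKC).trans (le_of_eq ?_)
  rw [Subgroup.commutator_comm]
  exact Subgroup.commutator_eq_bot_iff_le_centralizer.2 le_rfl

/-- Since `C_S(X) ≤ X`, `Ω₁(C_S(X))` lies in `V`, so `C_S(V)` centralizes it and may be appended to
the series. -/
theorem centralizer_omegaCenter_oliver_le [Finite S] [Group.IsNilpotent S] (hk : 3 ≤ k) :
    Subgroup.centralizer (omegaCenter p (oliver p k S) : Set S) ≤ oliver p k S := by
  have hC := centralizer_oliver_le (S := S) (p := p) hk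
  refine le_oliver_of_iterComm_eq_bot inferInstance ?_ ?_
  · exact fun x hx => Subgroup.mem_centralizer_iff.2 fun v hv => (omegaCenter_comm p hv hx).symm
  · refine iterComm_eq_bot_of_le (show 1 ≤ k - 1 by omega) ?_
    refine Subgroup.commutator_eq_bot_iff_le_centralizer.2 ?_
    refine (omegaOne_mono p ?_).trans (Subgroup.le_centralizer_iff.1 le_rfl)
    intro x hx
    refine ⟨⟨x, hC hx⟩, Subgroup.mem_center_iff.2 fun y => Subtype.ext ?_, rfl⟩
    exact Subgroup.mem_centralizer_iff.1 hx y y.2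

theorem coe_quotientRep_mk (X : Subgroup S) [X.Normal] (s : S) (v : omegaCenter p X) :
    ((quotientRep p X (s : S ⧸ X) (Additive.ofMul v)).toMul : S) = s * v * s⁻¹ := rfl

theorem quotientRep_injective (X : Subgroup S) [X.Normal]
    (hX : Subgroup.centralizer (omegaCenter p X : Set S) ≤ X) :
    Function.Injective (quotientRep p X) := by
  refine (injective_iff_map_eq_one _).2 fun g hg => ?_
  induction g using QuotientGroup.induction_on with
  | H s =>
    refine (QuotientGroup.eq_one_iff s).2 (hX (Subgroup.mem_centralizer_iff.2 fun v hv => ?_))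
    have h := coe_quotientRep_mk X s ⟨v, hv⟩
    rw [hg] at h
    have h : v = s * v * s⁻¹ := h
    exact mul_inv_eq_iff_eq_mul.1 h.symm |>.symm

theorem quotientRep_sub_one_sq (X : Subgroup S) [X.Normal] {b : S}
    (hb : ∀ v ∈ omegaCenter p X, Commute b ⁅b, v⁆) :
    (quotientRep p X (b : S ⧸ X) - 1) ^ 2 = 0 := by
  set f := quotientRep p X (b : S ⧸ X) with hf
  have key : ∀ v, f (f v - v) = f v - v := by
    intro v
    have h1 : ((f v - v).toMul : S) = ⁅b, (v.toMul : S)⁆ := by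
      rw [commutatorElement_def, ← div_eq_mul_inv]; rfl
    apply Additive.toMul.injective
    apply Subtype.ext
    have h2 : ((f (f v - v)).toMul : S) = b * ((f v - v).toMul : S) * b⁻¹ :=
      coe_quotientRep_mk X b _
    rw [h2, h1, (hb _ v.toMul.2).eq, mul_inv_cancel_right]
  refine LinearMap.ext fun v => ?_
  rw [sq]
  change f (f v - v) - (f v - v) = 0
  rw [key, sub_self]

end Faithful

/-! ### Minimal polynomial and order of a quadratic element -/

section Minpoly

theorem natDegree_minpoly_eq_two {F A : Type*} [Field F] [Ring A] [Algebra F A] {f : A}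
    (h : (f - 1) ^ 2 = 0) (h1 : f ≠ 1) : (minpoly F f).natDegree = 2 := by
  open Polynomial in
  have hae : aeval f ((X - C (1 : F)) ^ 2) = 0 := by simpa using h
  have hm : ((X - C (1 : F)) ^ 2).Monic := (monic_X_sub_C 1).pow 2
  have hint : IsIntegral F f := ⟨_, hm, hae⟩
  obtain ⟨i, hi, hass⟩ := (dvd_prime_pow (prime_X_sub_C (1 : F)) 2).1 (minpoly.dvd F f hae)
  have heq : minpoly F f = (X - C (1 : F)) ^ i :=
    eq_of_monic_of_associated (minpoly.monic hint) ((monic_X_sub_C 1).pow i) hass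
  have hz := minpoly.aeval F f
  rw [heq] at hz ⊢
  interval_cases i
  · have h10 : (1 : A) = 0 := by simpa using hz
    exact absurd (by rw [← mul_one f, h10, mul_zero]) h1
  · exact absurd (sub_eq_zero.1 (by simpa using hz)) h1
  · rw [natDegree_pow, natDegree_X_sub_C]

/-- The binomial expansion of `(1 + (f - 1)) ^ m` stops at the linear term. With faithfulness, this
gives `W` exponent `p`. -/
theorem pow_char_eq_one {R : Type*} [Ring R] {p : ℕ} (hp : (p : R) = 0) {f : R}
    (h : (f - 1) ^ 2 = 0) : f ^ p = 1 := by
  have key : ∀ m : ℕ, f ^ m = 1 + m * (f - 1) := by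
    intro m
    induction m with
    | zero => simp
    | succ m ih =>
      have h' : (f - 1) * f = f - 1 := by
        rw [sq, mul_sub, mul_one, sub_eq_zero] at h
        exact h
      rw [pow_succ, ih, add_mul, one_mul, mul_assoc, h']
      push_cast
      rw [add_mul, one_mul]
      abel
  rw [key, hp, zero_mul, add_zero]

end Minpoly

end OliverGroup

theorem mainTheorem6 (p k : ℕ) [Fact p.Prime] (hp : 5 ≤ p) (hk : 3 ≤ k) (hkp : k ≤ p)
    (S : Type*) [Group S] [Finite S] (hS : IsPGroup p S)
    (hJ : ¬ OliverGroup.thompson p S ≤ OliverGroup.oliver p k S) :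
    Function.Injective (OliverGroup.quotientRep p (OliverGroup.oliver p k S)) ∧
    ∃ (W : Subgroup (S ⧸ OliverGroup.oliver p k S)) (a : S ⧸ OliverGroup.oliver p k S),
      OliverGroup.IsQuadratic (OliverGroup.quotientRep p (OliverGroup.oliver p k S)) a ∧
      W = Subgroup.closure {b | ∃ g, b = g * a * g⁻¹} ∧
      W.Normal ∧
      OliverGroup.IsElemAb p W ∧
      ∀ x : S ⧸ OliverGroup.oliver p k S,
        OliverGroup.commElem W x = ⊥ ∨
          OliverGroup.commElem (OliverGroup.commElem W x) x ≠ ⊥ := by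
  open OliverGroup in
  have hnil : Group.IsNilpotent S := hS.isNilpotent
  set X := oliver p k S with hX
  set V := omegaCenter p X with hV
  have hCV : Subgroup.centralizer (V : Set S) ≤ X := centralizer_omegaCenter_oliver_le hk
  have hXC : X ≤ Subgroup.centralizer (V : Set S) := fun x hx =>
    Subgroup.mem_centralizer_iff.2 fun v hv => (omegaCenter_comm p hv hx).symm
  have hinj := quotientRep_injective X hCV
  refine ⟨hinj, ?_⟩
  have hVel : IsElemAb p V :=
    ⟨fun x hx y hy => omegaCenter_comm p hy (omegaCenter_le p X hx),
      fun x hx => omegaCenter_pow p hx⟩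
  obtain ⟨A, ⟨hA, hmax⟩, hAX⟩ : ∃ A : Subgroup S, (IsElemAb p A ∧
      ∀ B : Subgroup S, IsElemAb p B → Nat.card B ≤ Nat.card A) ∧ ¬ A ≤ X := by
    by_contra! hcon
    exact hJ (sSup_le hcon)
  obtain ⟨b, hbA, hbV, hbK⟩ := exists_quadratic_of_not_le_centralizer hA hmax hVel
    fun h => hAX (h.trans hCV)
  set ρ := quotientRep p X with hρ
  have hex : ∃ a, IsSquareZero (R := Module.End (ZMod p) (Additive V)) ρ a := by
    refine ⟨(b : S ⧸ X), fun h => hbV (hXC ((QuotientGroup.eq_one_iff b).1 h)),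
      quotientRep_sub_one_sq X fun v hv => ?_⟩
    have hmem : ⁅b, v⁆ ∈ ⁅V, A⁆ := by
      rw [Subgroup.commutator_comm]
      exact Subgroup.commutator_mem_commutator hbA hv
    exact (Subgroup.mem_centralizer_iff.1 hbK _ hmem).symm
  have hpz : ((p : ℕ) : Module.End (ZMod p) (Additive V)) = 0 := by
    rw [← map_natCast (algebraMap (ZMod p) _), ZMod.natCast_self, map_zero]
  -- Invertibility of 2 removes the factor 8 in `eight_mul_sq_sub_one_eq_zero`.
  have h2 : IsUnit (2 : Module.End (ZMod p) (Additive V)) := by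
    have h2' : (2 : ZMod p) ≠ 0 := by
      intro h
      have := (ZMod.natCast_eq_zero_iff 2 p).1 (by exact_mod_cast h)
      have := Nat.le_of_dvd (by norm_num) this
      omega
    have := (IsUnit.mk0 _ h2').map (algebraMap (ZMod p) (Module.End (ZMod p) (Additive V)))
    rwa [map_ofNat] at this
  obtain ⟨a, ha, hcomm, hcond⟩ := exists_commElem_ne_bot
    (Q := IsSquareZero (R := Module.End (ZMod p) (Additive V)) ρ)
    (fun x g hx => hx.conj g) (fun a x ha h1 h3 h4 => ha.commutator h2 h1 h3 h4)
    (fun x hx => hx.1) hex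
  have hset : Group.conjugatesOfSet {a} = {b | ∃ g, b = g * a * g⁻¹} := by
    ext b
    simp [Group.mem_conjugatesOfSet_iff, isConj_iff, eq_comm]
  refine ⟨Subgroup.normalClosure {a}, a, ?_, ?_, Subgroup.normalClosure_normal, ⟨hcomm, ?_⟩, hcond⟩
  · exact natDegree_minpoly_eq_two ha.2 fun h => ha.1 (hinj (h.trans (map_one ρ).symm))
  · rw [Subgroup.normalClosure, hset]
  · intro x hx
    induction hx using Subgroup.closure_induction with
    | mem x hx =>
      rw [hset] at hx
      obtain ⟨g, rfl⟩ := hx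
      refine hinj ?_
      rw [map_pow, map_one]
      exact pow_char_eq_one hpz (ha.conj g).2
    | one => simp
    | mul x y hx hy ihx ihy =>
      rw [(show Commute x y from hcomm x hx y hy).mul_pow, ihx, ihy, one_mul]
    | inv x hx ih => rw [inv_pow, ih, inv_one]
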